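/- Let $M$ be an $n$-dimensional smooth manifold and let $f : M \to \mathbb{R}$ be a positive smooth function. For a differential form $\varphi$ of degree $r$ put $d_f\varphi = f\,d\varphi - r\,df\wedge\varphi$. Let $r \ge 1$, let $U \subseteq M$ be open, and let $\varphi$ be a smooth $r$-form on $U$ with $d_f\varphi = 0$ on $U$. Then every point of $U$ has an open neighbourhood $U' \subseteq U$ on which there is a smooth $(r-1)$-form $\psi$ with $$\varphi \wedge df = d\psi \wedge df \quad\text{on } U',$$ that is, $\varphi$ is locally $d$-exact modulo $df$. -/

import Mathlib

open scoped Manifold ContDiff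

noncomputable section

namespace ManifoldForm

/-! ### Exterior algebra of a topological real vector space -/

section Wedge

variable {E : Type*} [AddCommGroup E] [Module ℝ E] [TopologicalSpace E]

/-- The tensor product `(α ⊗ β)(v₁, …, v_{p+q}) = α(v₁, …, v_p) * β(v_{p+1}, …, v_{p+q})`
of two alternating forms, as a multilinear form. -/
def tensor {p q : ℕ} (α : E [⋀^Fin p]→L[ℝ] ℝ) (β : E [⋀^Fin q]→L[ℝ] ℝ) :
    ContinuousMultilinearMap ℝ (fun _ : Fin (p + q) => E) ℝ where
  toMultilinearMap := ((LinearMap.mul' ℝ ℝ).compMultilinearMap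
    (α.toMultilinearMap.domCoprod β.toMultilinearMap)).domDomCongr finSumFinEquiv
  cont := by
    change Continuous fun v : Fin (p + q) → E =>
      α (fun i => v (finSumFinEquiv (Sum.inl i))) * β (fun i => v (finSumFinEquiv (Sum.inr i)))
    exact (α.cont.comp (by fun_prop)).mul (β.cont.comp (by fun_prop))

theorem tensor_apply {p q : ℕ} (α : E [⋀^Fin p]→L[ℝ] ℝ) (β : E [⋀^Fin q]→L[ℝ] ℝ)
    (v : Fin (p + q) → E) :
    tensor α β v = α (fun i => v (Fin.castAdd q i)) * β (fun i => v (Fin.natAdd p i)) :=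
  rfl

/-- The wedge product of a `p`-form and a `q`-form,
`(α ∧ β)(v₁, …, v_{p+q}) =
  1 / (p! q!) * ∑_σ sign σ * α(v_{σ 1}, …, v_{σ p}) * β(v_{σ (p+1)}, …, v_{σ (p+q)})`,
the sum being over all permutations `σ`. -/
def wedge {p q : ℕ} (α : E [⋀^Fin p]→L[ℝ] ℝ) (β : E [⋀^Fin q]→L[ℝ] ℝ) :
    E [⋀^Fin (p + q)]→L[ℝ] ℝ :=
  ((p.factorial : ℝ) * (q.factorial : ℝ))⁻¹ •
    ContinuousMultilinearMap.alternatization (tensor α β)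

theorem wedge_apply {p q : ℕ} (α : E [⋀^Fin p]→L[ℝ] ℝ) (β : E [⋀^Fin q]→L[ℝ] ℝ)
    (v : Fin (p + q) → E) :
    wedge α β v = ((p.factorial : ℝ) * (q.factorial : ℝ))⁻¹ * ∑ σ : Equiv.Perm (Fin (p + q)),
      Equiv.Perm.sign σ • (α (fun i => v (σ (Fin.castAdd q i))) *
        β (fun i => v (σ (Fin.natAdd p i)))) := by
  simp [wedge, ContinuousMultilinearMap.alternatization_apply_apply, tensor_apply]

/-- The same form with its arguments indexed by `Fin q`, where `p = q`. -/
def castDeg {p q : ℕ} (h : p = q) (α : E [⋀^Fin p]→L[ℝ] ℝ) : E [⋀^Fin q]→L[ℝ] ℝ where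
  toContinuousMultilinearMap := α.toContinuousMultilinearMap.domDomCongr (finCongr h)
  map_eq_zero_of_eq' v i j hv hij :=
    α.map_eq_zero_of_eq (fun k => v (finCongr h k)) (i := (finCongr h).symm i)
      (j := (finCongr h).symm j) (by simpa using hv) (by simpa using hij)

theorem castDeg_apply {p q : ℕ} (h : p = q) (α : E [⋀^Fin p]→L[ℝ] ℝ) (v : Fin q → E) :
    castDeg h α v = α (fun i => v (Fin.cast h i)) :=
  rfl

end Wedge

/-! ### Differential forms on a smooth manifold -/

section Manifold

variable {n : ℕ} {M : Type*} [TopologicalSpace M] [ChartedSpace (EuclideanSpace ℝ (Fin n)) M]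

/-- A (not necessarily smooth) differential form of degree `r` on the `n`-dimensional
manifold `M`: an alternating `r`-linear form on each tangent space. -/
abbrev Form (n : ℕ) (M : Type*) [TopologicalSpace M] [ChartedSpace (EuclideanSpace ℝ (Fin n)) M]
    (r : ℕ) : Type _ :=
  ∀ x : M, TangentSpace (𝓡 n) x [⋀^Fin r]→L[ℝ] ℝ

/-- The expression of a form in the chart `c`, that is, its pullback along `c⁻¹`, a form on the
model space (meaningful on the target of `c`). -/
def Form.inChart {r : ℕ} (φ : Form n M r)
    (c : OpenPartialHomeomorph M (EuclideanSpace ℝ (Fin n))) (y : EuclideanSpace ℝ (Fin n)) :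
    EuclideanSpace ℝ (Fin n) [⋀^Fin r]→L[ℝ] ℝ :=
  (φ (c.symm y)).compContinuousLinearMap (mfderiv (𝓡 n) (𝓡 n) c.symm y)

/-- The form `φ` is smooth (`C^∞`) on `U`: so is its expression in every chart of the atlas. -/
def Form.SmoothOn {r : ℕ} (φ : Form n M r) (U : Set M) : Prop :=
  ∀ c ∈ atlas (EuclideanSpace ℝ (Fin n)) M,
    ContDiffOn ℝ ∞ (φ.inChart c) (c.target ∩ c.symm ⁻¹' U)

/-- The exterior derivative of a form: at `x` it is the exterior derivative of the expression of
the form in the preferred chart at `x`, pulled back by this chart. -/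
def Form.d {r : ℕ} (φ : Form n M r) : Form n M (r + 1) := fun x =>
  (extDeriv (φ.inChart (chartAt (EuclideanSpace ℝ (Fin n)) x))
    (chartAt (EuclideanSpace ℝ (Fin n)) x x)).compContinuousLinearMap
      (mfderiv (𝓡 n) (𝓡 n) (chartAt (EuclideanSpace ℝ (Fin n)) x) x)

/-- The differential `df` of a function, as a form of degree one. -/
def diff (n : ℕ) {M : Type*} [TopologicalSpace M] [ChartedSpace (EuclideanSpace ℝ (Fin n)) M]
    (f : M → ℝ) : Form n M 1 := fun x =>
  ContinuousAlternatingMap.ofSubsingleton ℝ (TangentSpace (𝓡 n) x) ℝ (0 : Fin 1)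
    (mvfderiv (𝓡 n) f x)

/-- The pointwise wedge product of two forms. -/
def Form.wedge {p q : ℕ} (φ : Form n M p) (ψ : Form n M q) : Form n M (p + q) := fun x =>
  ManifoldForm.wedge (φ x) (ψ x)

/-- The operator `d_f φ = f dφ - r df ∧ φ` attached to the function `f`, on forms `φ` of
degree `r`. -/
def Form.dAttached (f : M → ℝ) {r : ℕ} (φ : Form n M r) : Form n M (r + 1) := fun x =>
  f x • φ.d x - (r : ℝ) • castDeg (Nat.add_comm 1 r) ((diff n f).wedge φ x)

end Manifold

end ManifoldForm

end

/-! With `h = (r + 1) log f` the equation `d_f φ = 0` reads `dφ = dh ∧ φ`, that is, `e^{-h} φ` is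
closed. By the Poincaré lemma `e^{-h} φ = dη` locally, so `ψ = e^h η` satisfies `φ = dψ - dh ∧ ψ`.
As `dh` is a multiple of `df`, the last term vanishes after taking the wedge product with `df`. -/

noncomputable section

namespace ManifoldForm

section Alternatization

variable {R M N ι ι' : Type*} [CommRing R] [AddCommGroup M] [Module R M] [AddCommGroup N]
  [Module R N]

theorem alternatization_domDomCongr [Fintype ι] [DecidableEq ι] [Fintype ι'] [DecidableEq ι']
    (e : ι ≃ ι') (T : MultilinearMap R (fun _ : ι => M) N) :
    MultilinearMap.alternatization (T.domDomCongr e) =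
      (MultilinearMap.alternatization T).domDomCongr e := by
  ext v
  rw [AlternatingMap.domDomCongr_apply, MultilinearMap.alternatization_apply,
    MultilinearMap.alternatization_apply, ← e.permCongr.sum_comp]
  simp [Function.comp_def]

theorem toMultilinearMap_alternatizeUncurryFin {k : ℕ} (f : M →ₗ[R] M [⋀^Fin k]→ₗ[R] N) :
    (AlternatingMap.alternatizeUncurryFin f).toMultilinearMap =
      ∑ i : Fin (k + 1), (-1 : ℤˣ) ^ (i : ℕ) •
        (LinearMap.uncurryLeft (M := fun _ : Fin (k + 1) => M)
          (AlternatingMap.toMultilinearMapLM ∘ₗ f)).domDomCongr i.cycleRange.symm := by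
  ext v
  have hterm (i : Fin (k + 1)) : LinearMap.uncurryLeft (M := fun _ : Fin (k + 1) => M)
      (AlternatingMap.toMultilinearMapLM ∘ₗ f) (fun j => v (i.cycleRange.symm j)) =
        f (v i) (i.removeNth v) := by
    change LinearMap.uncurryLeft _ (v ∘ i.cycleRange.symm) = _
    simp [← Fin.cons_removeNth_eq_comp_cycleRange_symm]
  simp [AlternatingMap.alternatizeUncurryFin_apply, Units.smul_def, hterm,
    -LinearMap.uncurryLeft_apply]

/-- Both sides become equal after multiplication by `k + 1`: each of the `k + 1` summands of
`alternatizeUncurryFin f` has the same alternatization, and alternatizing an alternating map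
multiplies it by `(k + 1)!`. -/
theorem alternatization_uncurryLeft [IsAddTorsionFree N] {k : ℕ}
    (f : M →ₗ[R] M [⋀^Fin k]→ₗ[R] N) :
    MultilinearMap.alternatization
        (LinearMap.uncurryLeft (M := fun _ : Fin (k + 1) => M)
          (AlternatingMap.toMultilinearMapLM ∘ₗ f)) =
      k.factorial • AlternatingMap.alternatizeUncurryFin f := by
  set T := LinearMap.uncurryLeft (M := fun _ : Fin (k + 1) => M)
    (AlternatingMap.toMultilinearMapLM ∘ₗ f)
  have hterm (i : Fin (k + 1)) : MultilinearMap.alternatization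
      ((-1 : ℤˣ) ^ (i : ℕ) • T.domDomCongr i.cycleRange.symm) =
        MultilinearMap.alternatization T := by
    rw [Units.smul_def, map_zsmul, alternatization_domDomCongr, AlternatingMap.domDomCongr_perm,
      Equiv.Perm.sign_symm, Fin.sign_cycleRange, ← Units.smul_def, smul_smul,
      Int.units_mul_self, one_smul]
  have hsum := AlternatingMap.coe_alternatization (AlternatingMap.alternatizeUncurryFin f)
  rw [toMultilinearMap_alternatizeUncurryFin, map_sum, Finset.sum_congr rfl fun i _ => hterm i,
    Finset.sum_const, Finset.card_univ, Fintype.card_fin, Nat.factorial_succ, mul_smul] at hsum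
  ext v
  exact nsmul_right_injective k.succ_ne_zero (DFunLike.congr_fun hsum v)

end Alternatization

section ExteriorMultiplication

open ContinuousAlternatingMap (ofSubsingleton)

variable {E F : Type*} [AddCommGroup E] [Module ℝ E] [TopologicalSpace E]
  [AddCommGroup F] [Module ℝ F] [TopologicalSpace F]

/-- The wedge product `a ∧ γ` of a linear form `a` and a `k`-form `γ`, with its arguments indexed
by `Fin (k + 1)` as those of an exterior derivative are. -/
def extMul {k : ℕ} (a : E →L[ℝ] ℝ) (γ : E [⋀^Fin k]→L[ℝ] ℝ) : E [⋀^Fin (k + 1)]→L[ℝ] ℝ :=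
  castDeg (Nat.add_comm 1 k) (wedge (ofSubsingleton ℝ E ℝ (0 : Fin 1) a) γ)

theorem toMultilinearMap_tensor_ofSubsingleton_left {k : ℕ} (a : E →L[ℝ] ℝ)
    (γ : E [⋀^Fin k]→L[ℝ] ℝ) :
    (tensor (ofSubsingleton ℝ E ℝ (0 : Fin 1) a) γ).toMultilinearMap.domDomCongr
        (finCongr (Nat.add_comm 1 k)) =
      LinearMap.uncurryLeft (M := fun _ : Fin (k + 1) => E)
        (AlternatingMap.toMultilinearMapLM ∘ₗ a.toLinearMap.smulRight γ.toAlternatingMap) := by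
  refine MultilinearMap.ext fun (v : Fin (k + 1) → E) => ?_
  have htail (i : Fin k) : Fin.cast (Nat.add_comm 1 k) (Fin.natAdd 1 i) = i.succ :=
    Fin.ext (Nat.add_comm 1 i)
  change a (v 0) * γ (fun i => v (Fin.cast (Nat.add_comm 1 k) (Fin.natAdd 1 i))) =
    a (v 0) * γ (Fin.tail v)
  simp only [htail, Fin.tail_def]

theorem toMultilinearMap_tensor_ofSubsingleton_right {k : ℕ} (γ : E [⋀^Fin k]→L[ℝ] ℝ)
    (a : E →L[ℝ] ℝ) :
    (tensor γ (ofSubsingleton ℝ E ℝ (0 : Fin 1) a)).toMultilinearMap =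
      (LinearMap.uncurryLeft (M := fun _ : Fin (k + 1) => E)
        (AlternatingMap.toMultilinearMapLM ∘ₗ
          a.toLinearMap.smulRight γ.toAlternatingMap)).domDomCongr (finRotate (k + 1)).symm := by
  refine MultilinearMap.ext fun (v : Fin (k + 1) → E) => ?_
  have hhead : (finRotate (k + 1)).symm 0 = Fin.natAdd k (0 : Fin 1) :=
    (Equiv.symm_apply_eq _).2 finRotate_last.symm
  have htail (i : Fin k) : (finRotate (k + 1)).symm i.succ = Fin.castAdd 1 i :=
    (Equiv.symm_apply_eq _).2 (finRotate_of_lt i.2).symm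
  change γ (fun i => v (Fin.castAdd 1 i)) * a (v (Fin.natAdd k 0)) =
    a (v ((finRotate (k + 1)).symm 0)) * γ (fun i => v ((finRotate (k + 1)).symm i.succ))
  simp only [hhead, htail, mul_comm]

theorem toAlternatingMap_extMul {k : ℕ} (a : E →L[ℝ] ℝ) (γ : E [⋀^Fin k]→L[ℝ] ℝ) :
    (extMul a γ).toAlternatingMap =
      AlternatingMap.alternatizeUncurryFin (a.toLinearMap.smulRight γ.toAlternatingMap) := by
  have hk : (k.factorial : ℝ) ≠ 0 := by positivity
  calc (extMul a γ).toAlternatingMap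
      = (((1 : ℕ).factorial : ℝ) * (k.factorial : ℝ))⁻¹ • (MultilinearMap.alternatization
          (tensor (ofSubsingleton ℝ E ℝ (0 : Fin 1) a) γ).toMultilinearMap).domDomCongr
            (finCongr (Nat.add_comm 1 k)) := by
        rw [← ContinuousMultilinearMap.alternatization_apply_toAlternatingMap]; rfl
    _ = _ := by
        rw [← alternatization_domDomCongr, toMultilinearMap_tensor_ofSubsingleton_left,
          alternatization_uncurryLeft, ← Nat.cast_smul_eq_nsmul ℝ, Nat.factorial_one, Nat.cast_one,
          one_mul, inv_smul_smul₀ hk]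

theorem wedge_ofSubsingleton_right {k : ℕ} (γ : E [⋀^Fin k]→L[ℝ] ℝ) (a : E →L[ℝ] ℝ) :
    wedge γ (ofSubsingleton ℝ E ℝ (0 : Fin 1) a) = (-1 : ℝ) ^ k • extMul a γ := by
  have hk : (k.factorial : ℝ) ≠ 0 := by positivity
  apply ContinuousAlternatingMap.toAlternatingMap_injective
  rw [wedge, ContinuousAlternatingMap.toAlternatingMap_smul,
    ContinuousMultilinearMap.alternatization_apply_toAlternatingMap,
    toMultilinearMap_tensor_ofSubsingleton_right, alternatization_domDomCongr,
    alternatization_uncurryLeft, AlternatingMap.domDomCongr_perm,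
    ContinuousAlternatingMap.toAlternatingMap_smul, toAlternatingMap_extMul,
    Equiv.Perm.sign_symm, sign_finRotate, ← Nat.cast_smul_eq_nsmul ℝ]
  ext v
  simp [Units.smul_def, mul_left_comm _ ((-1 : ℝ) ^ k), hk]

theorem extMul_apply {k : ℕ} (a : E →L[ℝ] ℝ) (γ : E [⋀^Fin k]→L[ℝ] ℝ) (v : Fin (k + 1) → E) :
    extMul a γ v = ∑ i : Fin (k + 1), (-1 : ℤ) ^ (i : ℕ) • (a (v i) * γ (i.removeNth v)) := by
  rw [← ContinuousAlternatingMap.coe_toAlternatingMap, toAlternatingMap_extMul,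
    AlternatingMap.alternatizeUncurryFin_apply]
  rfl

theorem extMul_smul_right {k : ℕ} (a : E →L[ℝ] ℝ) (c : ℝ) (γ : E [⋀^Fin k]→L[ℝ] ℝ) :
    extMul a (c • γ) = c • extMul a γ := by
  ext v
  simp [extMul_apply, Finset.mul_sum, mul_left_comm]

theorem extMul_sub_right {k : ℕ} (a : E →L[ℝ] ℝ) (γ δ : E [⋀^Fin k]→L[ℝ] ℝ) :
    extMul a (γ - δ) = extMul a γ - extMul a δ := by
  ext v
  simp [extMul_apply, mul_sub, Finset.sum_sub_distrib]

theorem extMul_smul_left {k : ℕ} (c : ℝ) (a : E →L[ℝ] ℝ) (γ : E [⋀^Fin k]→L[ℝ] ℝ) :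
    extMul (c • a) γ = c • extMul a γ := by
  ext v
  simp [extMul_apply, Finset.mul_sum, mul_left_comm, mul_assoc]

theorem extMul_neg_left {k : ℕ} (a : E →L[ℝ] ℝ) (γ : E [⋀^Fin k]→L[ℝ] ℝ) :
    extMul (-a) γ = -extMul a γ := by
  ext v
  simp [extMul_apply]

theorem extMul_extMul_self {k : ℕ} (a : E →L[ℝ] ℝ) (γ : E [⋀^Fin k]→L[ℝ] ℝ) :
    extMul a (extMul a γ) = 0 := by
  apply ContinuousAlternatingMap.toAlternatingMap_injective
  have hsymm := AlternatingMap.alternatizeUncurryFin_alternatizeUncurryFinLM_comp_of_symmetric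
    (f := a.toLinearMap.smulRight (a.toLinearMap.smulRight γ.toAlternatingMap))
    (fun x y => by ext; simp [mul_left_comm])
  have hcomp : a.toLinearMap.smulRight (extMul a γ).toAlternatingMap =
      AlternatingMap.alternatizeUncurryFinLM ∘ₗ
        a.toLinearMap.smulRight (a.toLinearMap.smulRight γ.toAlternatingMap) := by
    ext x : 1
    simp [toAlternatingMap_extMul]
  rw [toAlternatingMap_extMul, hcomp, hsymm]
  rfl

theorem wedge_sub_extMul_ofSubsingleton {k : ℕ} (β : E [⋀^Fin (k + 1)]→L[ℝ] ℝ) (c : ℝ)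
    (a : E →L[ℝ] ℝ) (γ : E [⋀^Fin k]→L[ℝ] ℝ) :
    wedge (β - extMul (c • a) γ) (ofSubsingleton ℝ E ℝ (0 : Fin 1) a) =
      wedge β (ofSubsingleton ℝ E ℝ (0 : Fin 1) a) := by
  rw [wedge_ofSubsingleton_right, wedge_ofSubsingleton_right, extMul_sub_right,
    extMul_smul_left, extMul_smul_right, extMul_extMul_self, smul_zero, sub_zero]

theorem extMul_compContinuousLinearMap {k : ℕ} (a : F →L[ℝ] ℝ) (γ : F [⋀^Fin k]→L[ℝ] ℝ)
    (L : E →L[ℝ] F) :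
    (extMul a γ).compContinuousLinearMap L =
      extMul (a.comp L) (γ.compContinuousLinearMap L) := by
  ext v
  simp only [extMul_apply, ContinuousAlternatingMap.compContinuousLinearMap_apply]
  rfl

end ExteriorMultiplication

section ParametricIntegral

open Set MeasureTheory intervalIntegral

universe u v

variable {E : Type u} [NormedAddCommGroup E] [NormedSpace ℝ E] {a b : ℝ}

/-- The tube lemma bounds the derivative uniformly on `[a, b]` near `x`, without any compactness
in the directions of `E`. -/
theorem hasFDerivAt_intervalIntegral_of_continuousOn {G : Type*} [NormedAddCommGroup G]
    [NormedSpace ℝ G] {F : E × ℝ → G} {F' : E × ℝ → E →L[ℝ] G} {s : Set (E × ℝ)} (hs : IsOpen s)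
    (hF : ContinuousOn F s) (hF' : ContinuousOn F' s)
    (hFF' : ∀ p ∈ s, HasFDerivAt (fun y => F (y, p.2)) (F' p) p.1)
    {x : E} (hx : ∀ t ∈ uIcc a b, (x, t) ∈ s) :
    HasFDerivAt (fun y => ∫ t in a..b, F (y, t)) (∫ t in a..b, F' (x, t)) x := by
  have hF'x : ContinuousOn (fun t => F' (x, t)) (uIcc a b) := hF'.comp (by fun_prop) hx
  obtain ⟨C, hC⟩ := isCompact_uIcc.exists_bound_of_continuousOn hF'x
  obtain ⟨u, v, hu, -, hxu, hv, huv⟩ := generalized_tube_lemma isCompact_singleton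
    isCompact_uIcc (hF'.norm.isOpen_inter_preimage hs (isOpen_Iio (a := C + 1)))
    (s := {x}) (t := uIcc a b) (by
      rintro ⟨y, t⟩ ⟨rfl, ht⟩
      exact ⟨hx t ht, (hC t ht).trans_lt (lt_add_one C)⟩)
  have hmem {y : E} (hy : y ∈ u) {t : ℝ} (ht : t ∈ uIcc a b) : (y, t) ∈ s :=
    (huv ⟨hy, hv ht⟩).1
  have hu_nhds : u ∈ nhds x := hu.mem_nhds (hxu rfl)
  have hFy {y : E} (hy : y ∈ u) : IntervalIntegrable (fun t => F (y, t)) volume a b :=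
    (hF.comp (by fun_prop) fun t ht => hmem hy ht).intervalIntegrable
  exact hasFDerivAt_integral_of_dominated_of_fderiv_le (bound := fun _ => C + 1) hu_nhds
    (Filter.eventually_of_mem hu_nhds fun y hy => (hFy hy).def'.aestronglyMeasurable)
    (hFy (hxu rfl)) hF'x.intervalIntegrable.def'.aestronglyMeasurable
    (.of_forall fun t ht y hy => (huv ⟨hy, hv (uIoc_subset_uIcc ht)⟩).2.le)
    intervalIntegrable_const
    (.of_forall fun t ht y hy => hFF' (y, t) (hmem hy (uIoc_subset_uIcc ht)))

theorem contDiffOn_intervalIntegral {G : Type (max u v)} [NormedAddCommGroup G] [NormedSpace ℝ G]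
    {F : E × ℝ → G} {s : Set (E × ℝ)} (hs : IsOpen s) (hF : ContDiffOn ℝ ∞ F s) {U : Set E}
    (hU : IsOpen U) (hUs : U ×ˢ uIcc a b ⊆ s) :
    ContDiffOn ℝ ∞ (fun y => ∫ t in a..b, F (y, t)) U := by
  have hfderiv {G : Type (max u v)} [NormedAddCommGroup G] [NormedSpace ℝ G] {F : E × ℝ → G}
      (hF : ContDiffOn ℝ ∞ F s) :
      ContDiffOn ℝ ∞ (fun p => (fderiv ℝ F p).comp (.inl ℝ E ℝ)) s :=
    (hF.fderiv_of_isOpen hs (by simp)).clm_comp contDiffOn_const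
  have hderiv {G : Type (max u v)} [NormedAddCommGroup G] [NormedSpace ℝ G] {F : E × ℝ → G}
      (hF : ContDiffOn ℝ ∞ F s) (x : E) (hx : x ∈ U) :=
    hasFDerivAt_intervalIntegral_of_continuousOn hs hF.continuousOn (hfderiv hF).continuousOn
      (fun p hp => ((hF.contDiffAt (hs.mem_nhds hp)).differentiableAt
        (by simp)).hasFDerivAt.comp p.1 (hasFDerivAt_prodMk_left p.1 p.2))
      fun t ht => hUs ⟨hx, ht⟩
  rw [contDiffOn_infty]
  intro n
  induction n generalizing G with
  | zero =>
    exact contDiffOn_zero.2 fun x hx => (hderiv hF x hx).continuousAt.continuousWithinAt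
  | succ n ih =>
    push_cast
    rw [contDiffOn_succ_iff_fderiv_of_isOpen hU]
    exact ⟨fun x hx => (hderiv hF x hx).differentiableAt.differentiableWithinAt, by simp,
      (ih (hfderiv hF)).congr fun x hx => (hderiv hF x hx).fderiv⟩

end ParametricIntegral

section PoincareLemma

set_option maxSynthPendingDepth 3

open Set ContinuousAlternatingMap

universe u v

variable {E : Type u} [NormedAddCommGroup E] [NormedSpace ℝ E]
  {G : Type v} [NormedAddCommGroup G] [NormedSpace ℝ G] {k : ℕ}

theorem curryLeft_alternatizeUncurryFin (D : E →L[ℝ] E [⋀^Fin (k + 1)]→L[ℝ] G) (u : E) :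
    (alternatizeUncurryFin D).curryLeft u =
      D u - alternatizeUncurryFin ((curryLeftLI.toContinuousLinearMap ∘L D).flip u) := by
  ext v
  have hsucc (i : Fin (k + 1)) : i.succ.removeNth (Matrix.vecCons u v : Fin (k + 2) → E) =
      (Matrix.vecCons u (i.removeNth v) : Fin (k + 1) → E) := by
    ext j
    cases j using Fin.cases <;> simp [Fin.removeNth]
  have hzero : (0 : Fin (k + 2)).removeNth (Matrix.vecCons u v : Fin (k + 2) → E) = v := by
    ext j
    simp [Fin.removeNth]
  rw [curryLeft_apply_apply, alternatizeUncurryFin_apply, Fin.sum_univ_succ,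
    ContinuousAlternatingMap.sub_apply, alternatizeUncurryFin_apply]
  simp [hsucc, hzero, pow_succ, sub_eq_add_neg]

/-- The integrand of the homotopy operator of the Poincaré lemma: the contraction with `∂/∂t` of
the pullback of `θ` along the contraction `(t, y) ↦ y₀ + t • (y - y₀)` to `y₀`. -/
def homotopyIntegrand (y₀ : E) (θ : E → E [⋀^Fin (k + 1)]→L[ℝ] G) (p : E × ℝ) :
    E [⋀^Fin k]→L[ℝ] G :=
  p.2 ^ k • (θ (y₀ + p.2 • (p.1 - y₀))).curryLeft (p.1 - y₀)

/-- The homotopy operator of the Poincaré lemma for the contraction to the point `y₀`. -/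
def poincareHomotopy (y₀ : E) (θ : E → E [⋀^Fin (k + 1)]→L[ℝ] G) (y : E) :
    E [⋀^Fin k]→L[ℝ] G :=
  ∫ t in (0 : ℝ)..1, homotopyIntegrand y₀ θ (y, t)

/-- The partial derivative of `homotopyIntegrand y₀ θ` in the direction of `E`. -/
def homotopyIntegrandDeriv (y₀ : E) (θ : E → E [⋀^Fin (k + 1)]→L[ℝ] G) (p : E × ℝ) :
    E →L[ℝ] E [⋀^Fin k]→L[ℝ] G :=
  p.2 ^ k • ((θ (y₀ + p.2 • (p.1 - y₀))).curryLeft +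
    p.2 • (curryLeftLI.toContinuousLinearMap ∘L
      fderiv ℝ θ (y₀ + p.2 • (p.1 - y₀))).flip (p.1 - y₀))

variable {y₀ : E} {θ : E → E [⋀^Fin (k + 1)]→L[ℝ] G} {V : Set E}

theorem isOpen_preimage_contraction (hV : IsOpen V) :
    IsOpen ((fun p : E × ℝ => y₀ + p.2 • (p.1 - y₀)) ⁻¹' V) :=
  hV.preimage (by fun_prop)

theorem contDiffOn_homotopyIntegrand {m : WithTop ℕ∞} (hθ : ContDiffOn ℝ m θ V) :
    ContDiffOn ℝ m (homotopyIntegrand y₀ θ) ((fun p => y₀ + p.2 • (p.1 - y₀)) ⁻¹' V) := by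
  have hγ : ContDiffOn ℝ m (fun p : E × ℝ => y₀ + p.2 • (p.1 - y₀))
      ((fun p => y₀ + p.2 • (p.1 - y₀)) ⁻¹' V) := by fun_prop
  have hθ' := curryLeftLI.contDiff.comp_contDiffOn (hθ.comp hγ fun _ hp => hp)
  exact (contDiffOn_snd.pow k).smul (hθ'.clm_apply (by fun_prop))

theorem continuousOn_homotopyIntegrandDeriv (hV : IsOpen V) (hθ : ContDiffOn ℝ 1 θ V) :
    ContinuousOn (homotopyIntegrandDeriv y₀ θ)
      ((fun p => y₀ + p.2 • (p.1 - y₀)) ⁻¹' V) := by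
  have hγ : ContinuousOn (fun p : E × ℝ => y₀ + p.2 • (p.1 - y₀))
      ((fun p => y₀ + p.2 • (p.1 - y₀)) ⁻¹' V) := by fun_prop
  have hθ' := curryLeftLI.continuous.comp_continuousOn (hθ.continuousOn.comp hγ fun _ hp => hp)
  have hDθ := (hθ.continuousOn_fderiv_of_isOpen hV le_rfl).comp hγ fun _ hp => hp
  refine (continuousOn_snd.pow k).smul (hθ'.add (continuousOn_snd.smul ?_))
  exact ((ContinuousLinearMap.flipₗᵢ ℝ E E (E [⋀^Fin k]→L[ℝ] G)).continuous.comp_continuousOn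
    (continuousOn_const.clm_comp hDθ)).clm_apply (by fun_prop)

theorem hasFDerivAt_homotopyIntegrand {p : E × ℝ}
    (hθ : DifferentiableAt ℝ θ (y₀ + p.2 • (p.1 - y₀))) :
    HasFDerivAt (fun y => homotopyIntegrand y₀ θ (y, p.2)) (homotopyIntegrandDeriv y₀ θ p) p.1 := by
  have hγ : HasFDerivAt (fun y : E => y₀ + p.2 • (y - y₀)) (p.2 • ContinuousLinearMap.id ℝ E) p.1 :=
    (((hasFDerivAt_id p.1).sub_const y₀).const_smul p.2).const_add y₀
  let K := (curryLeftLI (𝕜 := ℝ) (E := E) (F := G) (n := k)).toContinuousLinearMap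
  have hθ' : HasFDerivAt (fun y => (θ (y₀ + p.2 • (y - y₀))).curryLeft) _ p.1 :=
    K.hasFDerivAt.comp (g := K) p.1 (hθ.hasFDerivAt.comp (g := θ) p.1 hγ)
  refine ((hθ'.clm_apply ((hasFDerivAt_id p.1).sub_const y₀)).const_smul
    (p.2 ^ k)).congr_fderiv ?_
  ext1 w
  simp [homotopyIntegrandDeriv, K]

/-- Cartan's formula for the radial vector field, along the segment from `y₀` to `y`. -/
theorem hasDerivAt_pow_smul_comp_segment {y : E} {t : ℝ}
    (hθ : DifferentiableAt ℝ θ (y₀ + t • (y - y₀))) :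
    HasDerivAt (fun t : ℝ => t ^ (k + 1) • θ (y₀ + t • (y - y₀)))
      (alternatizeUncurryFin (homotopyIntegrandDeriv y₀ θ (y, t)) +
        homotopyIntegrand y₀ (extDeriv θ) (y, t)) t := by
  have hγ : HasDerivAt (fun t : ℝ => y₀ + t • (y - y₀)) (y - y₀) t := by
    simpa using ((hasDerivAt_id t).smul_const (y - y₀)).const_add y₀
  refine ((hasDerivAt_pow (k + 1) t).smul
    (hθ.hasFDerivAt.comp_hasDerivAt t hγ)).congr_deriv ?_
  rw [homotopyIntegrandDeriv, homotopyIntegrand, extDeriv, curryLeft_alternatizeUncurryFin,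
    alternatizeUncurryFin_smul, alternatizeUncurryFin_add, alternatizeUncurryFin_smul,
    alternatizeUncurryFin_curryLeft, ← Nat.cast_smul_eq_nsmul ℝ (k + 1)]
  simp only [Function.comp_apply, Nat.add_sub_cancel]
  module

theorem add_smul_sub_mem_of_mem_uIcc (hstar : StarConvex ℝ y₀ V) {y : E} (hy : y ∈ V) (t : ℝ)
    (ht : t ∈ uIcc (0 : ℝ) 1) : y₀ + t • (y - y₀) ∈ V := by
  rw [uIcc_of_le zero_le_one] at ht
  exact hstar.add_smul_sub_mem hy ht.1 ht.2

theorem hasFDerivAt_poincareHomotopy (hV : IsOpen V) (hstar : StarConvex ℝ y₀ V)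
    (hθ : ContDiffOn ℝ 1 θ V) {y : E} (hy : y ∈ V) :
    HasFDerivAt (poincareHomotopy y₀ θ) (∫ t in (0 : ℝ)..1, homotopyIntegrandDeriv y₀ θ (y, t)) y :=
  hasFDerivAt_intervalIntegral_of_continuousOn (isOpen_preimage_contraction hV)
    (contDiffOn_homotopyIntegrand hθ).continuousOn (continuousOn_homotopyIntegrandDeriv hV hθ)
    (fun _ hp => hasFDerivAt_homotopyIntegrand
      ((hθ.contDiffAt (hV.mem_nhds hp)).differentiableAt one_ne_zero))
    (add_smul_sub_mem_of_mem_uIcc hstar hy)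

theorem extDeriv_poincareHomotopy_add [CompleteSpace G] (hV : IsOpen V) (hstar : StarConvex ℝ y₀ V)
    (hθ : ContDiffOn ℝ 1 θ V) {y : E} (hy : y ∈ V) :
    extDeriv (poincareHomotopy y₀ θ) y + poincareHomotopy y₀ (extDeriv θ) y = θ y := by
  set A := alternatizeUncurryFinCLM (n := k) ℝ E G
  have hseg := add_smul_sub_mem_of_mem_uIcc hstar hy
  have hF' : ContinuousOn (fun t => homotopyIntegrandDeriv y₀ θ (y, t)) (uIcc 0 1) :=
    (continuousOn_homotopyIntegrandDeriv hV hθ).comp (by fun_prop) hseg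
  have hAF' : ContinuousOn (fun t => A (homotopyIntegrandDeriv y₀ θ (y, t))) (uIcc 0 1) :=
    A.continuous.comp_continuousOn hF'
  have hdθ : ContinuousOn (extDeriv θ) V :=
    (alternatizeUncurryFinCLM ℝ E G).continuous.comp_continuousOn
      (hθ.continuousOn_fderiv_of_isOpen hV le_rfl)
  have hHdθ : ContinuousOn (fun t => homotopyIntegrand y₀ (extDeriv θ) (y, t)) (uIcc 0 1) :=
    (contDiffOn_homotopyIntegrand (contDiffOn_zero.2 hdθ)).continuousOn.comp (by fun_prop) hseg
  have hextDeriv : extDeriv (poincareHomotopy y₀ θ) y =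
      ∫ t in (0 : ℝ)..1, A (homotopyIntegrandDeriv y₀ θ (y, t)) := by
    rw [extDeriv, (hasFDerivAt_poincareHomotopy hV hstar hθ hy).fderiv,
      A.intervalIntegral_comp_comm hF'.intervalIntegrable]
    rfl
  calc extDeriv (poincareHomotopy y₀ θ) y + poincareHomotopy y₀ (extDeriv θ) y
      = ∫ t in (0 : ℝ)..1, (A (homotopyIntegrandDeriv y₀ θ (y, t)) +
          homotopyIntegrand y₀ (extDeriv θ) (y, t)) := by
        rw [hextDeriv, poincareHomotopy, intervalIntegral.integral_add hAF'.intervalIntegrable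
          hHdθ.intervalIntegrable]
    _ = (1 : ℝ) ^ (k + 1) • θ (y₀ + (1 : ℝ) • (y - y₀)) -
          (0 : ℝ) ^ (k + 1) • θ (y₀ + (0 : ℝ) • (y - y₀)) :=
        intervalIntegral.integral_eq_sub_of_hasDerivAt
          (fun t ht => hasDerivAt_pow_smul_comp_segment
            ((hθ.contDiffAt (hV.mem_nhds (hseg t ht))).differentiableAt one_ne_zero))
          (hAF'.add hHdθ).intervalIntegrable
    _ = θ y := by simp

theorem contDiffOn_poincareHomotopy (hV : IsOpen V) (hstar : StarConvex ℝ y₀ V)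
    (hθ : ContDiffOn ℝ ∞ θ V) : ContDiffOn ℝ ∞ (poincareHomotopy y₀ θ) V :=
  contDiffOn_intervalIntegral (isOpen_preimage_contraction hV)
    (contDiffOn_homotopyIntegrand hθ) hV
    fun p hp => add_smul_sub_mem_of_mem_uIcc hstar hp.1 p.2 hp.2

theorem exists_extDeriv_eq_of_starConvex [CompleteSpace G] (hV : IsOpen V)
    (hstar : StarConvex ℝ y₀ V) (hθ : ContDiffOn ℝ ∞ θ V) (hd : EqOn (extDeriv θ) 0 V) :
    ∃ η : E → E [⋀^Fin k]→L[ℝ] G, ContDiffOn ℝ ∞ η V ∧ EqOn (extDeriv η) θ V := by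
  refine ⟨poincareHomotopy y₀ θ, contDiffOn_poincareHomotopy hV hstar hθ, fun y hy => ?_⟩
  have hzero : poincareHomotopy y₀ (extDeriv θ) y = 0 := by
    refine (intervalIntegral.integral_congr fun t ht => ?_).trans intervalIntegral.integral_zero
    simp only [homotopyIntegrand, hd (add_smul_sub_mem_of_mem_uIcc hstar hy t ht), Pi.zero_apply,
      curryLeft_zero, zero_apply, smul_zero]
  rw [← extDeriv_poincareHomotopy_add hV hstar (hθ.of_le (by simp)) hy, hzero, add_zero]

end PoincareLemma

section TwistedPoincareLemma

open ContinuousAlternatingMap (alternatizeUncurryFin alternatizeUncurryFin_apply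
  alternatizeUncurryFin_add alternatizeUncurryFin_smul)

variable {E : Type*} [NormedAddCommGroup E] [NormedSpace ℝ E] {k : ℕ}

theorem extMul_eq_alternatizeUncurryFin (a : E →L[ℝ] ℝ) (γ : E [⋀^Fin k]→L[ℝ] ℝ) :
    extMul a γ = alternatizeUncurryFin (a.smulRight γ) := by
  ext v
  rw [extMul_apply, alternatizeUncurryFin_apply]
  rfl

theorem extDeriv_function_smul {h : E → ℝ} {α : E → E [⋀^Fin k]→L[ℝ] ℝ} {z : E}
    (hh : DifferentiableAt ℝ h z) (hα : DifferentiableAt ℝ α z) :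
    extDeriv (fun x => h x • α x) z = extMul (fderiv ℝ h z) (α z) + h z • extDeriv α z := by
  rw [extDeriv, fderiv_fun_smul hh hα, alternatizeUncurryFin_add, alternatizeUncurryFin_smul,
    extMul_eq_alternatizeUncurryFin]
  exact add_comm _ _

theorem extDeriv_exp_smul {h : E → ℝ} {α : E → E [⋀^Fin k]→L[ℝ] ℝ} {z : E}
    (hh : DifferentiableAt ℝ h z) (hα : DifferentiableAt ℝ α z) :
    extDeriv (fun x => Real.exp (h x) • α x) z =
      Real.exp (h z) • (extMul (fderiv ℝ h z) (α z) + extDeriv α z) := by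
  rw [extDeriv_function_smul hh.exp hα, fderiv_exp hh, extMul_smul_left, smul_add]

theorem exists_eq_extDeriv_sub_extMul_of_starConvex {V : Set E} (hV : IsOpen V) {z₀ : E}
    (hstar : StarConvex ℝ z₀ V) {h : E → ℝ} (hh : ContDiffOn ℝ ∞ h V)
    {α : E → E [⋀^Fin (k + 1)]→L[ℝ] ℝ} (hα : ContDiffOn ℝ ∞ α V)
    (hd : ∀ z ∈ V, extDeriv α z = extMul (fderiv ℝ h z) (α z)) :
    ∃ β : E → E [⋀^Fin k]→L[ℝ] ℝ, ContDiffOn ℝ ∞ β V ∧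
      ∀ z ∈ V, α z = extDeriv β z - extMul (fderiv ℝ h z) (β z) := by
  have hdiff (z : E) (hz : z ∈ V) : DifferentiableAt ℝ h z :=
    (hh.differentiableOn (by simp)).differentiableAt (hV.mem_nhds hz)
  have hclosed : V.EqOn (extDeriv fun z => Real.exp (-h z) • α z) 0 := fun z hz => by
    have hαz := (hα.differentiableOn (by simp)).differentiableAt (hV.mem_nhds hz)
    rw [extDeriv_exp_smul (hdiff z hz).fun_neg hαz, fderiv_fun_neg, hd z hz,
      extMul_neg_left, neg_add_cancel, smul_zero]
    rfl
  obtain ⟨η, hη, hdη⟩ := exists_extDeriv_eq_of_starConvex hV hstar (hh.neg.exp.smul hα) hclosed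
  refine ⟨fun z => Real.exp (h z) • η z, hh.exp.smul hη, fun z hz => ?_⟩
  have hηz := (hη.differentiableOn (by simp)).differentiableAt (hV.mem_nhds hz)
  have hdηz : extDeriv η z = Real.exp (-h z) • α z := hdη hz
  rw [extDeriv_exp_smul (hdiff z hz) hηz, hdηz, smul_add, extMul_smul_right,
    add_sub_cancel_left, smul_smul, ← Real.exp_add, add_neg_cancel, Real.exp_zero, one_smul]

end TwistedPoincareLemma

section Pullback

open ContinuousAlternatingMap (isEmbedding_toContinuousMultilinearMap toContinuousMultilinearMapLI)
open ContinuousMultilinearMap (domDomCongrₗᵢ)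

variable {E F G ι : Type*} [NormedAddCommGroup E] [NormedSpace ℝ E] [NormedAddCommGroup F]
  [NormedSpace ℝ F] [NormedAddCommGroup G] [NormedSpace ℝ G] [Fintype ι]

@[fun_prop]
theorem continuous_alternatization [DecidableEq ι] :
    Continuous (ContinuousMultilinearMap.alternatization :
      ContinuousMultilinearMap ℝ (fun _ : ι => E) G →+ E [⋀^ι]→L[ℝ] G) := by
  have h (f : ContinuousMultilinearMap ℝ (fun _ : ι => E) G) :
      (ContinuousMultilinearMap.alternatization f).toContinuousMultilinearMap =
        ∑ σ : Equiv.Perm ι, Equiv.Perm.sign σ • domDomCongrₗᵢ ℝ E G σ f := by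
    ext v
    rw [sum_apply]
    exact ContinuousMultilinearMap.alternatization_apply_apply f v
  simp only [isEmbedding_toContinuousMultilinearMap.continuous_iff, Function.comp_def, h]
  exact continuous_finsetSum _ fun σ _ => (domDomCongrₗᵢ ℝ E G σ).continuous.const_smul _

variable (E G ι) in
/-- The projection of the multilinear forms onto the alternating ones: the average of the signed
permutations of the arguments. -/
def antisymmetrize [DecidableEq ι] :
    ContinuousMultilinearMap ℝ (fun _ : ι => E) G →L[ℝ] E [⋀^ι]→L[ℝ] G where
  toFun f := ((Fintype.card ι).factorial : ℝ)⁻¹ • ContinuousMultilinearMap.alternatization f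
  map_add' f g := by rw [map_add, smul_add]
  map_smul' c f := by
    ext v
    simp [ContinuousMultilinearMap.alternatization_apply_apply, Finset.smul_sum,
      smul_comm _ c]
  cont := by fun_prop

theorem antisymmetrize_toContinuousMultilinearMap [DecidableEq ι] (α : E [⋀^ι]→L[ℝ] G) :
    antisymmetrize E G ι α.toContinuousMultilinearMap = α := by
  have hcard : ((Fintype.card ι).factorial : ℝ) ≠ 0 := by positivity
  apply ContinuousAlternatingMap.toAlternatingMap_injective
  change ((Fintype.card ι).factorial : ℝ)⁻¹ • (ContinuousMultilinearMap.alternatization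
    α.toContinuousMultilinearMap).toAlternatingMap = α.toAlternatingMap
  have hα : MultilinearMap.alternatization α.toMultilinearMap =
      (Fintype.card ι).factorial • α.toAlternatingMap := α.toAlternatingMap.coe_alternatization
  rw [ContinuousMultilinearMap.alternatization_apply_toAlternatingMap, hα,
    ← Nat.cast_smul_eq_nsmul ℝ, inv_smul_smul₀ hcard]

theorem contDiffAt_compContinuousLinearMap {X : Type*} [NormedAddCommGroup X] [NormedSpace ℝ X]
    {α : X → F [⋀^ι]→L[ℝ] G} {L : X → E →L[ℝ] F} {x : X} {m : WithTop ℕ∞}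
    (hα : ContDiffAt ℝ m α x) (hL : ContDiffAt ℝ m L x) :
    ContDiffAt ℝ m (fun y => (α y).compContinuousLinearMap (L y)) x := by
  classical
  have hα' := (toContinuousMultilinearMapLI (𝕜 := ℝ)).contDiff.comp_contDiffAt x hα
  have hcomp := ContinuousMultilinearMap.cpolynomialAt_uncurry_compContinuousLinearMap.contDiffAt
    |>.comp x ((contDiffAt_pi.2 fun _ => hL).prodMk hα')
  refine ((antisymmetrize E G ι).contDiff.comp_contDiffAt x hcomp).congr_of_eventuallyEq ?_
  exact .of_forall fun y => (antisymmetrize_toContinuousMultilinearMap _).symm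

end Pullback

section Chart

variable {n r : ℕ} {M : Type*} [TopologicalSpace M] [ChartedSpace (EuclideanSpace ℝ (Fin n)) M]

local notation "𝔼" => EuclideanSpace ℝ (Fin n)

/-- The form on `M` obtained by pulling back a form `β` on the model space along the chart `c`. It
is the form with expression `β` in this chart, and is meaningful on the source of `c`. -/
def ofChart (c : OpenPartialHomeomorph M 𝔼) (β : 𝔼 → 𝔼 [⋀^Fin r]→L[ℝ] ℝ) : Form n M r := fun x =>
  (β (c x)).compContinuousLinearMap (mfderiv (𝓡 n) (𝓡 n) c x)

variable [IsManifold (𝓡 n) ∞ M] {c c' : OpenPartialHomeomorph M (EuclideanSpace ℝ (Fin n))}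

theorem mdifferentiable_chart (hc : c ∈ atlas 𝔼 M) : c.MDifferentiable (𝓡 n) (𝓡 n) :=
  haveI : IsManifold (𝓡 n) 1 M := IsManifold.of_le (n := ∞) (by simp)
  mdifferentiable_of_mem_atlas hc

theorem inChart_ofChart (hc : c ∈ atlas 𝔼 M) (β : 𝔼 → 𝔼 [⋀^Fin r]→L[ℝ] ℝ) {z : 𝔼}
    (hz : z ∈ c.target) : (ofChart c β : Form n M r).inChart c z = β z := by
  have hid := (mdifferentiable_chart hc).comp_symm_deriv hz
  unfold Form.inChart ofChart
  rw [c.right_inv hz]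
  change (β z).compContinuousLinearMap
    ((mfderiv (𝓡 n) (𝓡 n) c (c.symm z)).comp (mfderiv (𝓡 n) (𝓡 n) c.symm z)) = β z
  rw [hid]
  rfl

theorem extDeriv_inChart_ofChart (hc : c ∈ atlas 𝔼 M) (β : 𝔼 → 𝔼 [⋀^Fin r]→L[ℝ] ℝ) {z : 𝔼}
    (hz : z ∈ c.target) :
    extDeriv ((ofChart c β : Form n M r).inChart c) z = extDeriv β z :=
  Filter.EventuallyEq.extDeriv_eq <| by
    filter_upwards [c.open_target.mem_nhds hz] with w hw using inChart_ofChart hc β hw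

theorem ofChart_inChart (hc : c ∈ atlas 𝔼 M) (φ : Form n M r) {x : M} (hx : x ∈ c.source) :
    ofChart c (φ.inChart c) x = φ x := by
  obtain ⟨z, hz, rfl⟩ : ∃ z ∈ c.target, c.symm z = x := ⟨c x, c.map_source hx, c.left_inv hx⟩
  have hid := (mdifferentiable_chart hc).symm_comp_deriv hx
  unfold ofChart Form.inChart
  rw [c.right_inv hz] at hid ⊢
  change (φ (c.symm z)).compContinuousLinearMap
    ((mfderiv (𝓡 n) (𝓡 n) c.symm z).comp (mfderiv (𝓡 n) (𝓡 n) c (c.symm z))) = φ (c.symm z)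
  rw [hid]
  rfl

theorem eq_of_inChart_eq (hc : c ∈ atlas 𝔼 M) {φ ψ : Form n M r} {x : M} (hx : x ∈ c.source)
    (h : φ.inChart c (c x) = ψ.inChart c (c x)) : φ x = ψ x := by
  rw [← ofChart_inChart hc φ hx, ← ofChart_inChart hc ψ hx, ofChart, h, ofChart]

theorem contDiffAt_transition (hc : c ∈ atlas 𝔼 M) (hc' : c' ∈ atlas 𝔼 M) {z : 𝔼}
    (hz : z ∈ c.target) (hz' : c.symm z ∈ c'.source) : ContDiffAt ℝ ∞ (c' ∘ c.symm) z :=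
  contMDiffAt_iff_contDiffAt.1 <|
    ((contMDiffOn_of_mem_maximalAtlas (IsManifold.subset_maximalAtlas hc')).contMDiffAt
      (c'.open_source.mem_nhds hz')).comp z
    ((contMDiffOn_symm_of_mem_maximalAtlas (IsManifold.subset_maximalAtlas hc)).contMDiffAt
      (c.open_target.mem_nhds hz))

theorem fderiv_transition (hc : c ∈ atlas 𝔼 M) (hc' : c' ∈ atlas 𝔼 M) {z : 𝔼}
    (hz : z ∈ c.target) (hz' : c.symm z ∈ c'.source) :
    fderiv ℝ (c' ∘ c.symm) z = (mfderiv (𝓡 n) (𝓡 n) c' (c.symm z)).comp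
      (mfderiv (𝓡 n) (𝓡 n) c.symm z) :=
  mfderiv_eq_fderiv.symm.trans <| mfderiv_comp z
    ((mdifferentiable_chart hc').mdifferentiableAt hz')
    ((mdifferentiable_chart hc).mdifferentiableAt_symm hz)

theorem inChart_eq_pullback_transition (φ : Form n M r) (hc : c ∈ atlas 𝔼 M)
    (hc' : c' ∈ atlas 𝔼 M) {z : 𝔼} (hz : z ∈ c.target) (hz' : c.symm z ∈ c'.source) :
    φ.inChart c z = (φ.inChart c' ((c' ∘ c.symm) z)).compContinuousLinearMap
      (fderiv ℝ (c' ∘ c.symm) z) := by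
  rw [Form.inChart, ← ofChart_inChart hc' φ hz', fderiv_transition hc hc' hz hz']
  rfl

theorem inChart_eventuallyEq_pullback_transition (φ : Form n M r) (hc : c ∈ atlas 𝔼 M)
    (hc' : c' ∈ atlas 𝔼 M) {z : 𝔼} (hz : z ∈ c.target) (hz' : c.symm z ∈ c'.source) :
    φ.inChart c =ᶠ[nhds z] fun w => (φ.inChart c' ((c' ∘ c.symm) w)).compContinuousLinearMap
      (fderiv ℝ (c' ∘ c.symm) w) := by
  filter_upwards [(c.symm.isOpen_inter_preimage c'.open_source).mem_nhds ⟨hz, hz'⟩] with w hw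
  exact inChart_eq_pullback_transition φ hc hc' hw.1 hw.2

theorem smoothOn_ofChart (hc : c ∈ atlas 𝔼 M) {β : 𝔼 → 𝔼 [⋀^Fin r]→L[ℝ] ℝ} {V : Set 𝔼}
    (hV : IsOpen V) (hβ : ContDiffOn ℝ ∞ β V) :
    (ofChart c β : Form n M r).SmoothOn (c.source ∩ c ⁻¹' V) := by
  rintro c' hc' z ⟨hz, hzc, hzV⟩
  have hτ := contDiffAt_transition hc' hc hz hzc
  have hβ' : ContDiffAt ℝ ∞ β ((c ∘ c'.symm) z) := hβ.contDiffAt (hV.mem_nhds hzV)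
  have hpull := contDiffAt_compContinuousLinearMap (hβ'.comp z hτ)
    (hτ.fderiv_right (m := ∞) (by simp))
  refine (hpull.congr_of_eventuallyEq ?_).contDiffWithinAt
  filter_upwards [(c'.symm.isOpen_inter_preimage c.open_source).mem_nhds ⟨hz, hzc⟩] with w hw
  rw [inChart_eq_pullback_transition _ hc' hc hw.1 hw.2,
    inChart_ofChart hc β (show (c ∘ c'.symm) w ∈ c.target from c.map_source hw.2)]
  rfl

theorem inChart_d {φ : Form n M r} {U : Set M} (hU : IsOpen U) (hφ : φ.SmoothOn U)
    (hc : c ∈ atlas 𝔼 M) {z : 𝔼} (hz : z ∈ c.target) (hzU : c.symm z ∈ U) :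
    φ.d.inChart c z = extDeriv (φ.inChart c) z := by
  set c' := chartAt 𝔼 (c.symm z)
  have hc' : c' ∈ atlas 𝔼 M := chart_mem_atlas 𝔼 _
  have hz' : c.symm z ∈ c'.source := mem_chart_source 𝔼 _
  have hφ' : DifferentiableAt ℝ (φ.inChart c') ((c' ∘ c.symm) z) :=
    ((hφ c' hc').contDiffAt ((c'.symm.isOpen_inter_preimage hU).mem_nhds
      ⟨c'.map_source hz', by simpa [c'.left_inv hz'] using hzU⟩)).differentiableAt (by simp)
  have htwo : minSmoothness ℝ 2 ≤ ∞ := by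
    simpa using WithTop.coe_le_coe.2 (le_top : (2 : ℕ∞) ≤ ⊤)
  rw [(inChart_eventuallyEq_pullback_transition φ hc hc' hz hz').extDeriv_eq,
    extDeriv_pullback hφ' (contDiffAt_transition hc hc' hz hz') htwo,
    fderiv_transition hc hc' hz hz']
  rfl

theorem contDiffOn_comp_chart_symm {h : M → ℝ} {U : Set M}
    (hh : ContMDiffOn (𝓡 n) 𝓘(ℝ) ∞ h U) (hc : c ∈ atlas 𝔼 M) :
    ContDiffOn ℝ ∞ (h ∘ c.symm) (c.target ∩ c.symm ⁻¹' U) :=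
  contMDiffOn_iff_contDiffOn.1 <| hh.comp' <|
    contMDiffOn_symm_of_mem_maximalAtlas (IsManifold.subset_maximalAtlas hc)

theorem inChart_extMul_mvfderiv (φ : Form n M r) (hc : c ∈ atlas 𝔼 M) {z : 𝔼}
    (hz : z ∈ c.target) {h : M → ℝ} (hh : MDifferentiableAt (𝓡 n) 𝓘(ℝ) h (c.symm z)) :
    Form.inChart (fun x => extMul (mvfderiv (𝓡 n) h x) (φ x)) c z =
      extMul (fderiv ℝ (h ∘ c.symm) z) (φ.inChart c z) := by
  have hcomp : fderiv ℝ (h ∘ c.symm) z =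
      (mvfderiv (𝓡 n) h (c.symm z)).comp (mfderiv (𝓡 n) (𝓡 n) c.symm z) :=
    mfderiv_eq_fderiv.symm.trans <|
      mvfderiv_comp z hh ((mdifferentiable_chart hc).mdifferentiableAt_symm hz)
  rw [hcomp]
  exact extMul_compContinuousLinearMap _ _ _

theorem eq_d_sub_extMul_of_inChart {φ : Form n M (r + 1)} {ψ : Form n M r} {U : Set M}
    (hU : IsOpen U) (hψ : ψ.SmoothOn U) (hc : c ∈ atlas 𝔼 M) {x : M} (hx : x ∈ c.source)
    (hxU : x ∈ U) {h : M → ℝ} (hh : MDifferentiableAt (𝓡 n) 𝓘(ℝ) h x)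
    (heq : φ.inChart c (c x) = extDeriv (ψ.inChart c) (c x) -
      extMul (fderiv ℝ (h ∘ c.symm) (c x)) (ψ.inChart c (c x))) :
    φ x = ψ.d x - extMul (mvfderiv (𝓡 n) h x) (ψ x) := by
  have hz := c.map_source hx
  rw [← c.left_inv hx] at hxU hh
  rw [← inChart_d hU hψ hc hz hxU, ← inChart_extMul_mvfderiv ψ hc hz hh] at heq
  exact eq_of_inChart_eq (ψ := fun y => ψ.d y - extMul (mvfderiv (𝓡 n) h y) (ψ y)) hc hx heq

end Chart

section LocalExactness

theorem mvfderiv_comp_of_hasDerivAt {E H M : Type*} [NormedAddCommGroup E] [NormedSpace ℝ E]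
    [TopologicalSpace H] {I : ModelWithCorners ℝ E H} [TopologicalSpace M] [ChartedSpace H M]
    {f : M → ℝ} {g : ℝ → ℝ} {g' : ℝ} {x : M} (hg : HasDerivAt g g' (f x))
    (hf : MDifferentiableAt I 𝓘(ℝ) f x) :
    mvfderiv I (g ∘ f) x = g' • mvfderiv I f x := by
  have hcomp := (hg.hasFDerivAt.hasMFDerivAt.comp x hf.hasMFDerivAt).mfderiv
  ext v
  exact (DFunLike.congr_fun hcomp v).trans (mul_comm (mvfderiv I f x v) g')

variable {n r : ℕ} {M : Type*} [TopologicalSpace M] [ChartedSpace (EuclideanSpace ℝ (Fin n)) M]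
  [IsManifold (𝓡 n) ∞ M]

theorem exists_eq_d_sub_extMul_of_d_eq_extMul {h : M → ℝ} {U : Set M} (hU : IsOpen U)
    (hh : ContMDiffOn (𝓡 n) 𝓘(ℝ) ∞ h U) {φ : Form n M (r + 1)} (hφ : φ.SmoothOn U)
    (hd : ∀ x ∈ U, φ.d x = extMul (mvfderiv (𝓡 n) h x) (φ x)) {x : M} (hx : x ∈ U) :
    ∃ U' : Set M, IsOpen U' ∧ x ∈ U' ∧ U' ⊆ U ∧ ∃ ψ : Form n M r, ψ.SmoothOn U' ∧
      ∀ y ∈ U', φ y = ψ.d y - extMul (mvfderiv (𝓡 n) h y) (ψ y) := by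
  set c := chartAt (EuclideanSpace ℝ (Fin n)) x
  have hc : c ∈ atlas (EuclideanSpace ℝ (Fin n)) M := chart_mem_atlas _ x
  have hxc : x ∈ c.source := mem_chart_source _ x
  have hhx (y : M) (hy : y ∈ U) : MDifferentiableAt (𝓡 n) 𝓘(ℝ) h y :=
    (hh.contMDiffAt (hU.mem_nhds hy)).mdifferentiableAt (by simp)
  obtain ⟨ε, hε, hball⟩ := Metric.isOpen_iff.1 (c.symm.isOpen_inter_preimage hU) (c x)
    ⟨c.map_source hxc, by simpa [c.left_inv hxc] using hx⟩
  set V := Metric.ball (c x) ε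
  have hdchart : ∀ z ∈ V, extDeriv (φ.inChart c) z =
      extMul (fderiv ℝ (h ∘ c.symm) z) (φ.inChart c z) := by
    intro z hz
    obtain ⟨hzc, hzU⟩ := hball hz
    rw [← inChart_d hU hφ hc hzc hzU, ← inChart_extMul_mvfderiv φ hc hzc (hhx _ hzU),
      Form.inChart, Form.inChart, hd _ hzU]
  obtain ⟨β, hβ, hφβ⟩ := exists_eq_extDeriv_sub_extMul_of_starConvex Metric.isOpen_ball
    ((convex_ball _ _).starConvex (Metric.mem_ball_self hε))
    ((contDiffOn_comp_chart_symm hh hc).mono hball) ((hφ c hc).mono hball) hdchart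
  have hψ : (ofChart c β : Form n M r).SmoothOn (c.source ∩ c ⁻¹' V) :=
    smoothOn_ofChart hc Metric.isOpen_ball hβ
  have hU' : IsOpen (c.source ∩ c ⁻¹' V) := c.isOpen_inter_preimage Metric.isOpen_ball
  have hsub : c.source ∩ c ⁻¹' V ⊆ U := fun y ⟨hyc, hyV⟩ => by
    simpa [c.left_inv hyc] using (hball hyV).2
  refine ⟨_, hU', ⟨hxc, Metric.mem_ball_self hε⟩, hsub, _, hψ, fun y hy => ?_⟩
  have hyc := c.map_source hy.1
  refine eq_d_sub_extMul_of_inChart hU' hψ hc hy.1 hy (hhx y (hsub hy)) ?_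
  rw [extDeriv_inChart_ofChart hc β hyc, inChart_ofChart hc β hyc, hφβ _ hy.2]

end LocalExactness

end ManifoldForm

end

open ManifoldForm in
theorem proposition1p1_general {n : ℕ} {M : Type*} [TopologicalSpace M]
    [ChartedSpace (EuclideanSpace ℝ (Fin n)) M] [IsManifold (𝓡 n) ∞ M]
    {f : M → ℝ} {U : Set M} (hU : IsOpen U) (hf : ContMDiffOn (𝓡 n) 𝓘(ℝ) ∞ f U)
    (hf₀ : ∀ x ∈ U, f x ≠ 0) (c : ℝ) {r : ℕ} {φ : Form n M (r + 1)} (hφ : φ.SmoothOn U)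
    (hd : ∀ x ∈ U, f x • φ.d x = c • castDeg (Nat.add_comm 1 (r + 1)) ((diff n f).wedge φ x)) :
    ∀ x ∈ U, ∃ U' : Set M, IsOpen U' ∧ x ∈ U' ∧ U' ⊆ U ∧ ∃ ψ : Form n M r, ψ.SmoothOn U' ∧
      ∀ y ∈ U', φ.wedge (diff n f) y = ψ.d.wedge (diff n f) y := by
  intro x hx
  set h := (fun t => c * Real.log t) ∘ f
  have hh : ContMDiffOn (𝓡 n) 𝓘(ℝ) ∞ h U := fun y hy =>
    (contDiffAt_const.mul (Real.contDiffAt_log.2 (hf₀ y hy))).contMDiffAt.comp_contMDiffWithinAt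
      y (hf y hy)
  have hdh (y : M) (hy : y ∈ U) : mvfderiv (𝓡 n) h y = (c * (f y)⁻¹) • mvfderiv (𝓡 n) f y :=
    mvfderiv_comp_of_hasDerivAt ((Real.hasDerivAt_log (hf₀ y hy)).const_mul c)
      ((hf.contMDiffAt (hU.mem_nhds hy)).mdifferentiableAt (by simp))
  have hφh : ∀ y ∈ U, φ.d y = extMul (mvfderiv (𝓡 n) h y) (φ y) := fun y hy => by
    rw [hdh y hy, extMul_smul_left, mul_comm, mul_smul, eq_inv_smul_iff₀ (hf₀ y hy)]
    exact hd y hy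
  obtain ⟨U', hU', hxU', hsub, ψ, hψ, hφψ⟩ :=
    exists_eq_d_sub_extMul_of_d_eq_extMul hU hh hφ hφh hx
  refine ⟨U', hU', hxU', hsub, ψ, hψ, fun y hy => ?_⟩
  rw [Form.wedge, Form.wedge, hφψ y hy, hdh y (hsub hy)]
  exact wedge_sub_extMul_ofSubsingleton _ _ _ _

theorem proposition1p1 {n : ℕ} {M : Type*} [TopologicalSpace M]
    [ChartedSpace (EuclideanSpace ℝ (Fin n)) M] [IsManifold (𝓡 n) ∞ M]
    (f : M → ℝ) (hf : ContMDiff (𝓡 n) 𝓘(ℝ) ∞ f) (hpos : ∀ x, 0 < f x)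
    (r : ℕ) (U : Set M) (hU : IsOpen U)
    (φ : ManifoldForm.Form n M (r + 1)) (hφ : φ.SmoothOn U)
    (hd : ∀ x ∈ U, φ.dAttached f x = 0) :
    ∀ x ∈ U, ∃ U' : Set M, IsOpen U' ∧ x ∈ U' ∧ U' ⊆ U ∧
      ∃ ψ : ManifoldForm.Form n M r, ψ.SmoothOn U' ∧
        ∀ y ∈ U', φ.wedge (ManifoldForm.diff n f) y = ψ.d.wedge (ManifoldForm.diff n f) y :=
  proposition1p1_general hU hf.contMDiffOn (fun x _ => (hpos x).ne') _ hφ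
    fun x hx => sub_eq_zero.1 (hd x hx)
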